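/- Let $n\ge 3$ and let $B_n$ be the braid group on $n$ strands, given by Artin's presentation: generators $\sigma_1,\dots,\sigma_{n-1}$ and relations $\sigma_i\sigma_{i+1}\sigma_i=\sigma_{i+1}\sigma_i\sigma_{i+1}$ for $1\le i\le n-2$ and $\sigma_i\sigma_j=\sigma_j\sigma_i$ for $|i-j|\ge 2$. Let $P_n=\ker\pi$ be the pure braid group, where $\pi:B_n\to S_n$ sends $\sigma_i$ to the transposition $(i\;\,i+1)$. Let $$d=(\sigma_{n-1}\cdots\sigma_2\sigma_1)^n$$ be the full twist, and for $1\le i\le n$ let $$r_i=(\sigma_{i-1}\cdots\sigma_1)(\sigma_1\sigma_2\cdots\sigma_{n-1})(\sigma_{n-1}\sigma_{n-2}\cdots\sigma_i)$$ be the flip of the $i$-th strand (the first factor is empty for $i=1$, the last one for $i=n$). Let $R$ be the subgroup generated by $r_1,\dots,r_n$, and $S$ the subgroup generated by $d,r_1,\dots,r_n$. Then $R\subseteq S\subseteq P_n$, $R$ is normal in $S$, and $$S/R\cong\mathbb Z_2 .$$ Equivalently, $d^2\in R$ and $d\notin R$. -/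

import Mathlib

/-- Artin's braid relations for the generators `σ_1, …, σ_{n-1}`, indexed here by `Fin (n - 1)`
(the index `k` stands for `σ_{k+1}`): `σ_i σ_{i+1} σ_i = σ_{i+1} σ_i σ_{i+1}`, and
`σ_i σ_j = σ_j σ_i` for `|i - j| ≥ 2`. -/
inductive ArtinRel (n : ℕ) : FreeGroup (Fin (n - 1)) → Prop
  | braid (i j : Fin (n - 1)) (h : i.val + 1 = j.val) :
      ArtinRel n (FreeGroup.of i * FreeGroup.of j * FreeGroup.of i *
        (FreeGroup.of j * FreeGroup.of i * FreeGroup.of j)⁻¹)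
  | comm (i j : Fin (n - 1)) (h : i.val + 2 ≤ j.val) :
      ArtinRel n (FreeGroup.of i * FreeGroup.of j * (FreeGroup.of j * FreeGroup.of i)⁻¹)

/-- The braid group `B_n` on `n` strands, by Artin's presentation. -/
abbrev BraidGroup (n : ℕ) : Type := PresentedGroup {w | ArtinRel n w}

namespace BraidGroup

/-- The Artin generator twisting the adjacent strands `k` and `k + 1` (counted from `0`). -/
def sigma {n : ℕ} (k : Fin (n - 1)) : BraidGroup n := PresentedGroup.of k

/-- The transposition of the strands `k` and `k + 1` (counted from `0`). -/
def adjSwap {n : ℕ} (k : Fin (n - 1)) : Equiv.Perm (Fin n) :=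
  Equiv.swap ⟨k.val, by omega⟩ ⟨k.val + 1, by omega⟩

theorem adjSwap_rel {n : ℕ} (w : FreeGroup (Fin (n - 1))) (hw : w ∈ {w | ArtinRel n w}) :
    FreeGroup.lift (adjSwap (n := n)) w = 1 := by
  obtain ⟨i, j, h⟩ | ⟨i, j, h⟩ := hw
  · simp only [map_mul, map_inv, FreeGroup.lift_apply_of, mul_inv_eq_one]
    ext x
    simp only [adjSwap, Equiv.Perm.mul_apply, Equiv.swap_apply_def, Fin.ext_iff]
    grind
  · simp only [map_mul, map_inv, FreeGroup.lift_apply_of, mul_inv_eq_one]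
    ext x
    simp only [adjSwap, Equiv.Perm.mul_apply, Equiv.swap_apply_def, Fin.ext_iff]
    grind

/-- The homomorphism `π : B_n → S_n` recording how a braid permutes the strands. -/
def toPerm (n : ℕ) : BraidGroup n →* Equiv.Perm (Fin n) :=
  PresentedGroup.toGroup (f := adjSwap) adjSwap_rel

/-- The pure braid group `P_n = ker π`. -/
def pureSubgroup (n : ℕ) : Subgroup (BraidGroup n) := (toPerm n).ker

/-- The full twist `d = (σ_{n-1} ⋯ σ_2 σ_1)^n`. -/
def fullTwist (n : ℕ) : BraidGroup n :=
  (((List.finRange (n - 1)).reverse.map sigma).prod) ^ n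

/-- The flip of a strand. With strands counted from `1`, it is
`r_i = (σ_{i-1} ⋯ σ_1) (σ_1 ⋯ σ_{n-1}) (σ_{n-1} ⋯ σ_i)`; for `i = 1` the first factor is empty, and
for `i = n` the last one is. The argument below is `i - 1`. -/
def strandFlip {n : ℕ} (i : Fin n) : BraidGroup n :=
  ((((List.finRange (n - 1)).filter (fun k => k.val < i.val)).reverse.map sigma).prod) *
    (((List.finRange (n - 1)).map sigma).prod) *
    ((((List.finRange (n - 1)).filter (fun k => i.val ≤ k.val)).reverse.map sigma).prod)

/-- The subgroup `R` generated by the `n` flips. -/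
def flipSubgroup (n : ℕ) : Subgroup (BraidGroup n) :=
  Subgroup.closure (Set.range strandFlip)

/-- The subgroup `S` generated by the full twist and the `n` flips. -/
def twistFlipSubgroup (n : ℕ) : Subgroup (BraidGroup n) :=
  Subgroup.closure (insert (fullTwist n) (Set.range strandFlip))

end BraidGroup

/-!
Write `m = n - 1`, number the generators `σ_0, …, σ_{m-1}`, and put `δ = σ_{m-1} ⋯ σ_0`, so that
`d = δ ^ n`. With

* `J_i = (σ_{i-1} ⋯ σ_0) (σ_0 ⋯ σ_{i-1})`, in which strand `i` runs around all earlier strands,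
* `K_i = (σ_i ⋯ σ_{m-1}) (σ_{m-1} ⋯ σ_i)`, in which strand `i` runs around all later strands,

the flips are `r_i = J_i K_i`. A full twist on a block of strands is a full twist on the block without
its last (or first) strand times one such loop (`IsArtinSequence.twist_succ_last`,
`IsArtinSequence.twist_succ_first`), so `d = J_m ⋯ J_0 = K_m ⋯ K_0`. Since `J_j` commutes with `K_i`
for `j < i`, it follows that `r_m ⋯ r_0 = (J_m ⋯ J_0) (K_m ⋯ K_0) = d ^ 2`, which puts `d ^ 2` in `R`
(`BraidGroup.fullTwist_sq_mem`). Moreover `d` is central, because `δ σ_{i+1} = σ_i δ` and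
`δ ^ 2 σ_0 = σ_{m-1} δ ^ 2` (`IsArtinSequence.commute_twist`). Hence `R` is normal in `S`, with index
at most two.

That `d ∉ R` is seen by counting crossings: for every pair of strands `a ≠ b` the number of signed
crossings between them is additive on pure braids. It is encoded by an action of `B_n` on triples
`(a, b, z)` of two positions and an integer counter (`BraidGroup.crossingAction`). The flip `r_i` adds
`2` to the counter of the pairs that contain `i`, so an element of `R` adds `2 (c a + c b)` for some
function `c`, while `d` adds `2` for every pair. An equality `c a + c b = 1` for all `a ≠ b` is
impossible over `ℤ` as soon as there are three strands.
-/

/-! ### Sequences satisfying the braid relations -/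

/-- The first `m` terms of the sequence `s` satisfy Artin's braid relations. -/
structure IsArtinSequence {G : Type*} [Group G] (s : ℕ → G) (m : ℕ) : Prop where
  braid : ∀ i, i + 1 < m → s i * s (i + 1) * s i = s (i + 1) * s i * s (i + 1)
  comm : ∀ i j, i + 2 ≤ j → j < m → Commute (s i) (s j)

/-- The product `s a * s (a + 1) * ⋯ * s (a + k - 1)`. -/
def ascProd {G : Type*} [Group G] (s : ℕ → G) (a k : ℕ) : G :=
  ((List.range' a k).map s).prod

/-- The product `s (a + k - 1) * ⋯ * s (a + 1) * s a`. Its power with exponent `k + 1` is the full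
twist on the `k + 1` strands `a, …, a + k`. -/
def descProd {G : Type*} [Group G] (s : ℕ → G) (a k : ℕ) : G :=
  ((List.range' a k).reverse.map s).prod

section Products

variable {G : Type*} [Group G] (s : ℕ → G)

@[simp] theorem ascProd_zero (a : ℕ) : ascProd s a 0 = 1 := by simp [ascProd]

@[simp] theorem descProd_zero (a : ℕ) : descProd s a 0 = 1 := by simp [descProd]

theorem ascProd_succ (a k : ℕ) : ascProd s a (k + 1) = ascProd s a k * s (a + k) := by
  simp [ascProd, List.range'_concat]

theorem ascProd_succ' (a k : ℕ) : ascProd s a (k + 1) = s a * ascProd s (a + 1) k := by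
  simp [ascProd, List.range'_succ]

theorem descProd_succ (a k : ℕ) : descProd s a (k + 1) = s (a + k) * descProd s a k := by
  simp [descProd, List.range'_concat]

theorem descProd_succ' (a k : ℕ) : descProd s a (k + 1) = descProd s (a + 1) k * s a := by
  simp [descProd, List.range'_succ]

theorem descProd_add (a p q : ℕ) :
    descProd s a (p + q) = descProd s (a + p) q * descProd s a p := by
  induction q with
  | zero => simp
  | succ q ih => rw [← add_assoc, descProd_succ, ih, descProd_succ, mul_assoc, add_assoc]

variable {s}

theorem commute_ascProd {g : G} {a k : ℕ} (h : ∀ i, a ≤ i → i < a + k → Commute g (s i)) :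
    Commute g (ascProd s a k) := by
  induction k with
  | zero => simp
  | succ k ih =>
    rw [ascProd_succ]
    exact (ih fun i hi hk => h i hi (by omega)).mul_right (h _ (by omega) (by omega))

theorem commute_descProd {g : G} {a k : ℕ} (h : ∀ i, a ≤ i → i < a + k → Commute g (s i)) :
    Commute g (descProd s a k) := by
  induction k with
  | zero => simp
  | succ k ih =>
    rw [descProd_succ]
    exact (h _ (by omega) (by omega)).mul_right (ih fun i hi hk => h i hi (by omega))

end Products

/-! ### Full twists -/

namespace IsArtinSequence

variable {G : Type*} [Group G] {s : ℕ → G} {m : ℕ}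

theorem descProd_mul (h : IsArtinSequence s m) {a k i : ℕ} (hi : a ≤ i) (hik : i + 1 < a + k)
    (hk : a + k ≤ m) : descProd s a k * s (i + 1) = s i * descProd s a k := by
  obtain ⟨p, rfl⟩ := Nat.exists_eq_add_of_le hi
  obtain ⟨q, rfl⟩ : ∃ q, k = p + (2 + q) := ⟨k - p - 2, by omega⟩
  have h1 : Commute (s (a + p + 1)) (descProd s a p) :=
    commute_descProd fun i _ hi => (h.comm i _ (by omega) (by omega)).symm
  have h2 : Commute (s (a + p)) (descProd s (a + p + 2) q) :=
    commute_descProd fun i _ hi => h.comm _ i (by omega) (by omega)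
  have hb := h.braid (a + p) (by omega)
  have h3 : descProd s (a + p) 2 = s (a + p + 1) * s (a + p) := by simp [descProd_succ]
  rw [descProd_add, descProd_add s (a + p), h3]
  calc _ = descProd s (a + p + 2) q * (s (a + p + 1) * s (a + p)) *
          (descProd s a p * s (a + p + 1)) := by group
    _ = descProd s (a + p + 2) q * (s (a + p + 1) * s (a + p) * s (a + p + 1)) *
          descProd s a p := by rw [← h1.eq]; group
    _ = descProd s (a + p + 2) q * s (a + p) * (s (a + p + 1) * s (a + p)) *
          descProd s a p := by rw [← hb]; group
    _ = _ := by rw [← h2.eq]; group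

theorem descProd_mul_ascProd (h : IsArtinSequence s m) {a k i j : ℕ} (hi : a ≤ i)
    (hik : i + 1 + j ≤ a + k) (hk : a + k ≤ m) :
    descProd s a k * ascProd s (i + 1) j = ascProd s i j * descProd s a k := by
  induction j with
  | zero => simp
  | succ j ih =>
    rw [ascProd_succ, ← mul_assoc, ih (by omega), mul_assoc, show i + 1 + j = i + j + 1 by omega,
      h.descProd_mul (by omega) (by omega) hk, ascProd_succ, mul_assoc]

theorem descProd_pow_last (h : IsArtinSequence s m) {a k j p : ℕ} (hj : j + p = k + 1)
    (hk : a + (k + 1) ≤ m) :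
    descProd s a (k + 1) ^ j = ascProd s (a + p) j * descProd s a k ^ j := by
  induction j generalizing p with
  | zero => simp
  | succ j ih =>
    rw [pow_succ', ih (p := p + 1) (by omega), ← mul_assoc, ← add_assoc,
      h.descProd_mul_ascProd (by omega) (by omega) hk, descProd_succ, ascProd_succ,
      show a + p + j = a + k by omega, pow_succ']
    simp only [mul_assoc]

theorem descProd_pow_first (h : IsArtinSequence s m) {a k j : ℕ} (hj : j ≤ k + 1)
    (hk : a + (k + 1) ≤ m) :
    descProd s a (k + 1) ^ j = descProd s (a + 1) k ^ j * ascProd s a j := by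
  induction j with
  | zero => simp
  | succ j ih =>
    rw [pow_succ, ih (by omega), mul_assoc,
      ← h.descProd_mul_ascProd (a := a) (by omega) (by omega) hk, descProd_succ', ascProd_succ',
      pow_succ]
    simp only [mul_assoc]

/-- Splitting the last strand off a full twist. -/
theorem twist_succ_last (h : IsArtinSequence s m) {a k : ℕ} (hk : a + (k + 1) ≤ m) :
    descProd s a (k + 1) ^ (k + 2) =
      descProd s a (k + 1) * ascProd s a (k + 1) * descProd s a k ^ (k + 1) := by
  rw [pow_succ', h.descProd_pow_last (p := 0) (by omega) hk, mul_assoc, add_zero]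

/-- Splitting the first strand off a full twist. -/
theorem twist_succ_first (h : IsArtinSequence s m) {a k : ℕ} (hk : a + (k + 1) ≤ m) :
    descProd s a (k + 1) ^ (k + 2) =
      descProd s (a + 1) k ^ (k + 1) * (ascProd s a (k + 1) * descProd s a (k + 1)) := by
  rw [pow_succ, h.descProd_pow_first (by omega) hk, mul_assoc]

theorem descProd_pow_mul (h : IsArtinSequence s m) {i j : ℕ} (hij : i + j < m) :
    descProd s 0 m ^ j * s (i + j) = s i * descProd s 0 m ^ j := by
  induction j with
  | zero => simp
  | succ j ih =>
    rw [pow_succ, mul_assoc, ← add_assoc,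
      h.descProd_mul (by omega) (by omega) (by omega), ← mul_assoc, ih (by omega), mul_assoc]

theorem descProd_mul_descProd (h : IsArtinSequence s m) {k : ℕ} (hk : k + 1 ≤ m) :
    descProd s 0 m * descProd s 1 k = descProd s 0 k * descProd s 0 m := by
  induction k with
  | zero => simp
  | succ k ih =>
    rw [descProd_succ, ← mul_assoc, add_comm 1 k,
      h.descProd_mul (by omega) (by omega) (by omega), mul_assoc, ih (by omega), descProd_succ,
      zero_add, mul_assoc]

/-- The index shift `δ * s (i + 1) = s i * δ` wraps around from `0` to the last index under `δ ^ 2`. -/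
theorem descProd_sq_mul (h : IsArtinSequence s (m + 1)) :
    descProd s 0 (m + 1) ^ 2 * s 0 = s m * descProd s 0 (m + 1) ^ 2 := by
  have h1 := h.descProd_mul_descProd (k := m) le_rfl
  have h2 : descProd s 0 (m + 1) = descProd s 1 m * s 0 := descProd_succ' s 0 m
  have h3 : descProd s 0 (m + 1) = s m * descProd s 0 m := by simpa using descProd_succ s 0 m
  calc descProd s 0 (m + 1) ^ 2 * s 0
      = s m * (descProd s 0 m * descProd s 0 (m + 1)) * s 0 := by
        rw [pow_two, ← mul_assoc, ← h3]
    _ = s m * (descProd s 0 (m + 1) * (descProd s 1 m * s 0)) := by rw [← h1]; group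
    _ = _ := by rw [← h2, pow_two]

/-- The full twist commutes with every generator. -/
theorem commute_twist (h : IsArtinSequence s m) {i : ℕ} (hi : i < m) :
    Commute (descProd s 0 m ^ (m + 1)) (s i) := by
  obtain ⟨m, rfl⟩ : ∃ k, m = k + 1 := ⟨m - 1, by omega⟩
  have h1 := h.descProd_pow_mul (i := 0) (j := i) (by omega)
  have h2 := h.descProd_sq_mul
  have h3 := h.descProd_pow_mul (i := i) (j := m - i) (by omega)
  rw [zero_add] at h1
  rw [show i + (m - i) = m by omega] at h3
  -- The factor `δ ^ i` moves the index from `i` to `0`, `δ ^ 2` from `0` to `m`, and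
  -- `δ ^ (m - i)` from `m` back to `i`.
  have h4 : descProd s 0 (m + 1) ^ (m + 1 + 1) = descProd s 0 (m + 1) ^ (m - i) *
      (descProd s 0 (m + 1) ^ 2 * descProd s 0 (m + 1) ^ i) := by
    rw [← pow_add, ← pow_add]; congr 1; omega
  rw [commute_iff_eq, h4, mul_assoc, mul_assoc, h1, ← mul_assoc (_ ^ 2), h2, mul_assoc,
    ← mul_assoc, h3]
  simp only [mul_assoc]

end IsArtinSequence

/-! ### The braid group -/

namespace BraidGroup

/-- The Artin generators as a sequence indexed by `ℕ`, with value `1` from `n - 1` on. -/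
def gen (n : ℕ) (i : ℕ) : BraidGroup n := if h : i < n - 1 then sigma ⟨i, h⟩ else 1

theorem gen_of_lt {n i : ℕ} (h : i < n - 1) : gen n i = sigma ⟨i, h⟩ := dif_pos h

theorem isArtinSequence_gen (n : ℕ) : IsArtinSequence (gen n) (n - 1) where
  braid i hi := by
    rw [gen_of_lt hi, gen_of_lt (by omega : i < n - 1)]
    have := PresentedGroup.one_of_mem (rels := {w | ArtinRel n w})
      (ArtinRel.braid ⟨i, by omega⟩ ⟨i + 1, hi⟩ rfl)
    rw [map_mul, map_inv, mul_inv_eq_one] at this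
    exact this
  comm i j hij hj := by
    rw [gen_of_lt hj, gen_of_lt (by omega : i < n - 1)]
    have := PresentedGroup.one_of_mem (rels := {w | ArtinRel n w})
      (ArtinRel.comm ⟨i, by omega⟩ ⟨j, hj⟩ hij)
    rw [map_mul, map_inv, mul_inv_eq_one] at this
    exact this

theorem map_sigma_eq {n : ℕ} (l : List (Fin (n - 1))) :
    l.map sigma = (l.map Fin.val).map (gen n) := by
  rw [List.map_map]
  exact List.map_congr_left fun k _ => (gen_of_lt k.isLt).symm

theorem map_val_filter_finRange (m : ℕ) (p : ℕ → Bool) :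
    ((List.finRange m).filter fun k => p k.val).map Fin.val = (List.range m).filter p := by
  rw [← List.map_coe_finRange_eq_range, List.filter_map]
  rfl

theorem fullTwist_eq (n : ℕ) : fullTwist n = descProd (gen n) 0 (n - 1) ^ n := by
  rw [fullTwist, map_sigma_eq, List.map_reverse, List.map_coe_finRange_eq_range,
    List.range_eq_range']
  rfl

/-- A flip is a loop around the earlier strands times a loop around the later strands. -/
theorem strandFlip_eq {n : ℕ} (i : Fin n) :
    strandFlip i = descProd (gen n) 0 i * ascProd (gen n) 0 i *
      (ascProd (gen n) i (n - 1 - i) * descProd (gen n) i (n - 1 - i)) := by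
  have hn : n - 1 = i + (n - 1 - i) := by omega
  have hr : List.range (n - 1) = List.range' 0 i ++ List.range' i (n - 1 - i) := by
    rw [List.range_eq_range']
    conv_lhs => rw [hn]
    rw [← List.range'_append]; simp
  have h1 : (List.range (n - 1)).filter (fun k => decide (k < i.val)) = List.range' 0 i := by
    rw [hr, List.filter_append, List.filter_eq_self.2, List.filter_eq_nil_iff.2, List.append_nil]
    all_goals simp +contextual
  have h2 : (List.range (n - 1)).filter (fun k => decide (i.val ≤ k)) =
      List.range' i (n - 1 - i) := by
    rw [hr, List.filter_append, List.filter_eq_nil_iff.2, List.filter_eq_self.2, List.nil_append]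
    all_goals simp +contextual
  have h3 : ((List.finRange (n - 1)).map sigma).prod =
      ascProd (gen n) 0 i * ascProd (gen n) i (n - 1 - i) := by
    rw [map_sigma_eq, List.map_coe_finRange_eq_range, hr, List.map_append, List.prod_append]
    rfl
  rw [strandFlip, h3, map_sigma_eq, map_sigma_eq]
  simp only [List.map_reverse]
  rw [map_val_filter_finRange (n - 1) (fun k => decide (k < i.val)),
    map_val_filter_finRange (n - 1) (fun k => decide (i.val ≤ k)), h1, h2]
  simp only [descProd, List.map_reverse, mul_assoc]

theorem fullTwist_mem_center (n : ℕ) : fullTwist n ∈ Subgroup.center (BraidGroup n) := by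
  rcases n with _ | n
  · simp [fullTwist]
  rw [Subgroup.mem_center_iff]
  intro g
  have hg : g ∈ Subgroup.centralizer {fullTwist (n + 1)} := by
    have : g ∈ Subgroup.closure
        (Set.range (PresentedGroup.of (rels := {w | ArtinRel (n + 1) w}))) := by
      rw [PresentedGroup.closure_range_of]; trivial
    refine (Subgroup.closure_le _).2 ?_ this
    rintro _ ⟨k, rfl⟩
    have h := (isArtinSequence_gen (n + 1)).commute_twist k.isLt
    rw [gen_of_lt k.isLt] at h
    rw [SetLike.mem_coe, Subgroup.mem_centralizer_singleton_iff, fullTwist_eq]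
    exact h.eq.symm
  exact (Subgroup.mem_centralizer_singleton_iff.1 hg)

theorem strandFlip_mem {n : ℕ} (i : Fin n) : strandFlip i ∈ flipSubgroup n :=
  Subgroup.subset_closure ⟨i, rfl⟩

/-- The partial product `r_i ⋯ r_0` of flips is the full twist on the strands `0, …, i`, times the
inverse of the full twist on the strands `i + 1, …, m`, times the full twist on all strands. -/
theorem partial_flip_product_mem (m i : ℕ) (hi : i < m) :
    descProd (gen (m + 1)) 0 i ^ (i + 1) *
      (descProd (gen (m + 1)) (i + 1) (m - (i + 1)) ^ (m - i))⁻¹ * fullTwist (m + 1) ∈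
        flipSubgroup (m + 1) := by
  have h : IsArtinSequence (gen (m + 1)) m := isArtinSequence_gen (m + 1)
  have key : ∀ j, j < m → descProd (gen (m + 1)) j (m - j) ^ (m - j + 1) =
      descProd (gen (m + 1)) (j + 1) (m - (j + 1)) ^ (m - j) *
        (ascProd (gen (m + 1)) j (m - j) * descProd (gen (m + 1)) j (m - j)) := fun j hj => by
    obtain ⟨k, rfl⟩ : ∃ k, m = j + (k + 1) := ⟨m - j - 1, by omega⟩
    have := h.twist_succ_first (a := j) (k := k) le_rfl
    simpa [show j + (k + 1) - (j + 1) = k by omega] using this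
  induction i with
  | zero =>
    have h0 := strandFlip_mem (0 : Fin (m + 1))
    have hk := key 0 hi
    simp only [strandFlip_eq, Fin.val_zero, Nat.add_sub_cancel, descProd_zero, ascProd_zero,
      one_mul] at h0
    simp only [Nat.sub_zero] at hk h0
    have hd : fullTwist (m + 1) = descProd (gen (m + 1)) 0 m ^ (m + 1) := fullTwist_eq (m + 1)
    rw [hd, hk]
    simpa using h0
  | succ i ih =>
    have hr := (flipSubgroup (m + 1)).mul_mem
      (strandFlip_mem (⟨i + 1, by omega⟩ : Fin (m + 1))) (ih (by omega))
    convert hr using 1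
    have hk := key (i + 1) hi
    rw [show m - (i + 1) + 1 = m - i by omega] at hk
    rw [strandFlip_eq, hk, h.twist_succ_last (by omega : 0 + (i + 1) ≤ m)]
    simp only [Nat.add_sub_cancel]
    have hc : Commute (ascProd (gen (m + 1)) (i + 1) (m - (i + 1)) *
        descProd (gen (m + 1)) (i + 1) (m - (i + 1))) (descProd (gen (m + 1)) 0 i ^ (i + 1)) := by
      refine Commute.pow_right (commute_descProd fun p _ hp => Commute.symm ?_) _
      exact (commute_ascProd fun q hq hqm => h.comm p q (by omega) (by omega)).mul_right
        (commute_descProd fun q hq hqm => h.comm p q (by omega) (by omega))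
    rw [mul_inv_rev]
    generalize ascProd (gen (m + 1)) (i + 1) (m - (i + 1)) *
        descProd (gen (m + 1)) (i + 1) (m - (i + 1)) = K at hc ⊢
    generalize descProd (gen (m + 1)) 0 i ^ (i + 1) = T at hc ⊢
    generalize descProd (gen (m + 1)) 0 (i + 1) * ascProd (gen (m + 1)) 0 (i + 1) = J
    calc _ = J * (T * K) * K⁻¹ * (descProd (gen (m + 1)) (i + 1 + 1) (m - (i + 1 + 1)) ^
          (m - (i + 1)))⁻¹ * fullTwist (m + 1) := by group
      _ = _ := by rw [← hc.eq]; group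

/-- The product `r_m ⋯ r_0` of all flips is the square of the full twist. -/
theorem fullTwist_sq_mem (n : ℕ) : fullTwist n ^ 2 ∈ flipSubgroup n := by
  rcases n with _ | _ | m
  · simp [fullTwist]
  · simp [fullTwist]
  have h : IsArtinSequence (gen (m + 2)) (m + 1) := isArtinSequence_gen (m + 2)
  have hp := partial_flip_product_mem (m + 1) m (by omega)
  have hr := (flipSubgroup (m + 2)).mul_mem (strandFlip_mem (Fin.last (m + 1))) hp
  convert hr using 1
  have hd : fullTwist (m + 2) = descProd (gen (m + 2)) 0 (m + 1) ^ (m + 2) := fullTwist_eq (m + 2)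
  rw [strandFlip_eq, pow_two]
  conv_lhs => enter [1]; rw [hd, h.twist_succ_last (by omega : 0 + (m + 1) ≤ m + 1)]
  simp [mul_assoc]

/-! ### Loops and full twists under homomorphisms -/

theorem lastLoop_succ {G : Type*} [Group G] (s : ℕ → G) (a k : ℕ) :
    descProd s a (k + 1) * ascProd s a (k + 1) =
      s (a + k) * (descProd s a k * ascProd s a k) * s (a + k) := by
  rw [descProd_succ, ascProd_succ]; simp only [mul_assoc]

theorem firstLoop_succ {G : Type*} [Group G] (s : ℕ → G) (a k : ℕ) :
    ascProd s a (k + 1) * descProd s a (k + 1) =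
      s a * (ascProd s (a + 1) k * descProd s (a + 1) k) * s a := by
  rw [descProd_succ', ascProd_succ']; simp only [mul_assoc]

theorem toPerm_gen_mul_self (n i : ℕ) : toPerm n (gen n i) * toPerm n (gen n i) = 1 := by
  by_cases h : i < n - 1
  · have : toPerm n (gen n i) = adjSwap ⟨i, h⟩ := by
      rw [gen_of_lt h]; exact PresentedGroup.toGroup.of _
    rw [this, adjSwap, Equiv.swap_mul_self]
  · simp [gen, h]

theorem lastLoop_mem_pureSubgroup (n k : ℕ) :
    descProd (gen n) 0 k * ascProd (gen n) 0 k ∈ pureSubgroup n := by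
  induction k with
  | zero => simp
  | succ k ih =>
    rw [pureSubgroup, MonoidHom.mem_ker] at ih ⊢
    rw [lastLoop_succ, map_mul, map_mul, ih, mul_one, toPerm_gen_mul_self]

theorem firstLoop_mem_pureSubgroup (n a k : ℕ) :
    ascProd (gen n) a k * descProd (gen n) a k ∈ pureSubgroup n := by
  induction k generalizing a with
  | zero => simp
  | succ k ih =>
    have ih := ih (a + 1)
    rw [pureSubgroup, MonoidHom.mem_ker] at ih ⊢
    rw [firstLoop_succ, map_mul, map_mul, ih, mul_one, toPerm_gen_mul_self]

theorem strandFlip_mem_pureSubgroup {n : ℕ} (i : Fin n) : strandFlip i ∈ pureSubgroup n := by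
  rw [strandFlip_eq]
  exact mul_mem (lastLoop_mem_pureSubgroup n i) (firstLoop_mem_pureSubgroup n i _)

theorem twist_mem_pureSubgroup (n k : ℕ) (hk : k ≤ n - 1) :
    descProd (gen n) 0 k ^ (k + 1) ∈ pureSubgroup n := by
  induction k with
  | zero => simp
  | succ k ih =>
    rw [(isArtinSequence_gen n).twist_succ_last (by omega : 0 + (k + 1) ≤ n - 1)]
    exact mul_mem (lastLoop_mem_pureSubgroup n _) (ih (by omega))

theorem fullTwist_mem_pureSubgroup (n : ℕ) : fullTwist n ∈ pureSubgroup n := by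
  rcases n with _ | n
  · simp [fullTwist]
  rw [fullTwist_eq]
  exact twist_mem_pureSubgroup (n + 1) n le_rfl

theorem twistFlipSubgroup_le_pureSubgroup (n : ℕ) : twistFlipSubgroup n ≤ pureSubgroup n := by
  refine (Subgroup.closure_le _).2 (Set.insert_subset (fullTwist_mem_pureSubgroup n) ?_)
  rintro _ ⟨i, rfl⟩
  exact strandFlip_mem_pureSubgroup i

/-! ### Counting crossings -/

/-- Whether the crossing `σ_k` involves exactly the strands in positions `a` and `b`, as `0` or
`1`. -/
def crossingIndicator {n : ℕ} (k : Fin (n - 1)) (a b : Fin n) : ℤ :=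
  if (a.val = k.val ∧ b.val = k.val + 1) ∨ (b.val = k.val ∧ a.val = k.val + 1) then 1 else 0

theorem adjSwap_val {n : ℕ} (k : Fin (n - 1)) (a : Fin n) :
    (adjSwap k a).val =
      if a.val = k.val then k.val + 1 else if a.val = k.val + 1 then k.val else a.val := by
  simp only [adjSwap, Equiv.swap_apply_def, Fin.ext_iff]
  split_ifs <;> rfl

theorem crossingIndicator_adjSwap {n : ℕ} (k : Fin (n - 1)) (a b : Fin n) :
    crossingIndicator k (adjSwap k a) (adjSwap k b) = crossingIndicator k a b := by
  simp only [crossingIndicator, adjSwap_val]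
  grind

theorem adjSwap_adjSwap {n : ℕ} (k : Fin (n - 1)) (a : Fin n) : adjSwap k (adjSwap k a) = a :=
  Equiv.swap_apply_self _ _ a

/-- Conjugation by `σ_j σ_i` turns `σ_j` into `σ_i` for adjacent indices `i` and `j`; this is the
corresponding fact for the strands that cross. -/
theorem crossingIndicator_adjSwap_adjSwap {n : ℕ} {i j : Fin (n - 1)}
    (h : i.val + 1 = j.val ∨ j.val + 1 = i.val) (a b : Fin n) :
    crossingIndicator i (adjSwap j (adjSwap i a)) (adjSwap j (adjSwap i b)) =
      crossingIndicator j a b := by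
  have h0 (x : Fin n) : (adjSwap j (adjSwap i x)).val = i.val ↔ x.val = j.val := by
    simp only [adjSwap_val]
    grind
  have h1 (x : Fin n) : (adjSwap j (adjSwap i x)).val = i.val + 1 ↔ x.val = j.val + 1 := by
    simp only [adjSwap_val]
    grind
  simp only [crossingIndicator, h0, h1]

theorem crossingIndicator_adjSwap_of_comm {n : ℕ} {i j : Fin (n - 1)}
    (h : i.val + 2 ≤ j.val ∨ j.val + 2 ≤ i.val) (a b : Fin n) :
    crossingIndicator i (adjSwap j a) (adjSwap j b) = crossingIndicator i a b := by
  have h0 (x : Fin n) : (adjSwap j x).val = i.val ↔ x.val = i.val := by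
    simp only [adjSwap_val]
    grind
  have h1 (x : Fin n) : (adjSwap j x).val = i.val + 1 ↔ x.val = i.val + 1 := by
    simp only [adjSwap_val]
    grind
  simp only [crossingIndicator, h0, h1]

/-- The action of `σ_k` on triples of two positions and a counter: the positions are permuted, and
the counter goes up by one if the two strands cross. -/
def crossingPerm {n : ℕ} (k : Fin (n - 1)) : Equiv.Perm (Fin n × Fin n × ℤ) where
  toFun x := (adjSwap k x.1, adjSwap k x.2.1, x.2.2 + crossingIndicator k x.1 x.2.1)
  invFun x := (adjSwap k x.1, adjSwap k x.2.1, x.2.2 - crossingIndicator k x.1 x.2.1)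
  left_inv x := by simp [adjSwap_adjSwap, crossingIndicator_adjSwap]
  right_inv x := by simp [adjSwap_adjSwap, crossingIndicator_adjSwap]

theorem crossingPerm_apply {n : ℕ} (k : Fin (n - 1)) (a b : Fin n) (z : ℤ) :
    crossingPerm k (a, b, z) = (adjSwap k a, adjSwap k b, z + crossingIndicator k a b) := rfl

theorem crossingPerm_rel {n : ℕ} (w : FreeGroup (Fin (n - 1))) (hw : w ∈ {w | ArtinRel n w}) :
    FreeGroup.lift (crossingPerm (n := n)) w = 1 := by
  obtain ⟨i, j, h⟩ | ⟨i, j, h⟩ := hw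
  · simp only [map_mul, map_inv, FreeGroup.lift_apply_of, mul_inv_eq_one]
    refine Equiv.ext fun ⟨a, b, z⟩ => ?_
    simp only [Equiv.Perm.mul_apply, crossingPerm_apply, Prod.mk.injEq]
    refine ⟨?_, ?_, ?_⟩
    · simp only [Fin.ext_iff, adjSwap_val]
      grind
    · simp only [Fin.ext_iff, adjSwap_val]
      grind
    · have h1 := crossingIndicator_adjSwap_adjSwap (Or.inl h) a b
      have h2 := crossingIndicator_adjSwap_adjSwap (Or.inr h) a b
      have h3 := crossingIndicator_adjSwap_adjSwap (Or.inl h) (adjSwap i a) (adjSwap i b)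
      rw [adjSwap_adjSwap, adjSwap_adjSwap] at h3
      omega
  · simp only [map_mul, map_inv, FreeGroup.lift_apply_of, mul_inv_eq_one]
    refine Equiv.ext fun ⟨a, b, z⟩ => ?_
    simp only [Equiv.Perm.mul_apply, crossingPerm_apply, Prod.mk.injEq]
    refine ⟨?_, ?_, ?_⟩
    · simp only [Fin.ext_iff, adjSwap_val]
      grind
    · simp only [Fin.ext_iff, adjSwap_val]
      grind
    · have h1 := crossingIndicator_adjSwap_of_comm (Or.inl h) a b
      have h2 := crossingIndicator_adjSwap_of_comm (Or.inr h) a b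
      omega

/-- The action of the braid group on triples of two positions and a counter of the crossings
between the strands in these positions. -/
def crossingAction (n : ℕ) : BraidGroup n →* Equiv.Perm (Fin n × Fin n × ℤ) :=
  PresentedGroup.toGroup (f := crossingPerm) crossingPerm_rel

theorem crossingAction_gen {n i : ℕ} (h : i < n - 1) :
    crossingAction n (gen n i) = crossingPerm ⟨i, h⟩ := by
  rw [gen_of_lt h]; exact PresentedGroup.toGroup.of _

theorem crossingAction_lastLoop {n k : ℕ} (hk : k ≤ n - 1) (a b : Fin n) (z : ℤ) :
    crossingAction n (descProd (gen n) 0 k * ascProd (gen n) 0 k) (a, b, z) =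
      (a, b, z + if (a.val = k ∧ b.val < k) ∨ (b.val = k ∧ a.val < k) then 2 else 0) := by
  induction k generalizing a b z with
  | zero => simp
  | succ k ih =>
    rw [lastLoop_succ, zero_add, map_mul, map_mul, crossingAction_gen (by omega : k < n - 1),
      Equiv.Perm.mul_apply, Equiv.Perm.mul_apply, crossingPerm_apply, ih (by omega),
      crossingPerm_apply]
    simp only [adjSwap_adjSwap, crossingIndicator_adjSwap, Prod.mk.injEq, true_and]
    simp only [crossingIndicator, adjSwap_val]
    grind

theorem crossingAction_firstLoop {n k i : ℕ} (hk : i + k = n - 1) (a b : Fin n) (z : ℤ) :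
    crossingAction n (ascProd (gen n) i k * descProd (gen n) i k) (a, b, z) =
      (a, b, z + if (a.val = i ∧ i < b.val) ∨ (b.val = i ∧ i < a.val) then 2 else 0) := by
  induction k generalizing i a b z with
  | zero =>
    rw [if_neg (by omega)]
    simp
  | succ k ih =>
    rw [firstLoop_succ, map_mul, map_mul, crossingAction_gen (by omega : i < n - 1),
      Equiv.Perm.mul_apply, Equiv.Perm.mul_apply, crossingPerm_apply, ih (by omega),
      crossingPerm_apply]
    simp only [adjSwap_adjSwap, crossingIndicator_adjSwap, Prod.mk.injEq, true_and]
    simp only [crossingIndicator, adjSwap_val]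
    grind

theorem crossingAction_strandFlip {n : ℕ} (i : Fin n) {a b : Fin n} (hab : a ≠ b) (z : ℤ) :
    crossingAction n (strandFlip i) (a, b, z) =
      (a, b, z + 2 * ((if a = i then 1 else 0) + if b = i then 1 else 0)) := by
  rw [strandFlip_eq, map_mul, Equiv.Perm.mul_apply, crossingAction_firstLoop (by omega),
    crossingAction_lastLoop (by omega)]
  simp only [Prod.mk.injEq, true_and, Fin.ext_iff]
  have : a.val ≠ b.val := fun h => hab (Fin.ext h)
  grind

theorem crossingAction_twist {n k : ℕ} (hk : k ≤ n - 1) {a b : Fin n} (hab : a ≠ b) (z : ℤ) :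
    crossingAction n (descProd (gen n) 0 k ^ (k + 1)) (a, b, z) =
      (a, b, z + if a.val ≤ k ∧ b.val ≤ k then 2 else 0) := by
  have hne : a.val ≠ b.val := fun h => hab (Fin.ext h)
  induction k generalizing z with
  | zero =>
    rw [if_neg (by omega)]
    simp
  | succ k ih =>
    rw [(isArtinSequence_gen n).twist_succ_last (by omega : 0 + (k + 1) ≤ n - 1), map_mul,
      Equiv.Perm.mul_apply, ih (by omega), crossingAction_lastLoop hk]
    simp only [Prod.mk.injEq, true_and]
    grind

theorem crossingAction_fullTwist {n : ℕ} {a b : Fin n} (hab : a ≠ b) (z : ℤ) :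
    crossingAction n (fullTwist n) (a, b, z) = (a, b, z + 2) := by
  have hn : n = n - 1 + 1 := by omega
  have h := crossingAction_twist (le_refl (n - 1)) hab z
  rw [← hn, if_pos (by omega)] at h
  rw [fullTwist_eq, h]

theorem exists_crossingAction_eq_of_mem_flipSubgroup {n : ℕ} {g : BraidGroup n}
    (hg : g ∈ flipSubgroup n) : ∃ c : Fin n → ℤ, ∀ a b : Fin n, a ≠ b → ∀ z : ℤ,
      crossingAction n g (a, b, z) = (a, b, z + 2 * (c a + c b)) := by
  induction hg using Subgroup.closure_induction with
  | mem x hx =>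
    obtain ⟨i, rfl⟩ := hx
    exact ⟨fun a => if a = i then 1 else 0, fun a b hab z => crossingAction_strandFlip i hab z⟩
  | one => exact ⟨0, fun a b _ z => by simp⟩
  | mul x y _ _ hx hy =>
    obtain ⟨c, hc⟩ := hx
    obtain ⟨c', hc'⟩ := hy
    refine ⟨c + c', fun a b hab z => ?_⟩
    rw [map_mul, Equiv.Perm.mul_apply, hc' a b hab, hc a b hab, Pi.add_apply, Pi.add_apply]
    congr 2
    ring
  | inv x _ hx =>
    obtain ⟨c, hc⟩ := hx
    refine ⟨-c, fun a b hab z => ?_⟩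
    rw [map_inv, Equiv.Perm.inv_eq_iff_eq, hc a b hab, Pi.neg_apply, Pi.neg_apply]
    congr 2
    ring

theorem fullTwist_notMem_flipSubgroup {n : ℕ} (hn : 3 ≤ n) : fullTwist n ∉ flipSubgroup n := by
  intro h
  obtain ⟨c, hc⟩ := exists_crossingAction_eq_of_mem_flipSubgroup h
  have key : ∀ a b : Fin n, a ≠ b → c a + c b = 1 := fun a b hab => by
    have h1 := hc a b hab 0
    rw [crossingAction_fullTwist hab] at h1
    simp only [Prod.mk.injEq, true_and] at h1
    omega
  have h01 := key ⟨0, by omega⟩ ⟨1, by omega⟩ (by simp)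
  have h02 := key ⟨0, by omega⟩ ⟨2, by omega⟩ (by simp)
  have h12 := key ⟨1, by omega⟩ ⟨2, by omega⟩ (by simp)
  omega

/-! ### The quotient -/

theorem flipSubgroup_le_twistFlipSubgroup (n : ℕ) : flipSubgroup n ≤ twistFlipSubgroup n :=
  Subgroup.closure_mono (Set.subset_insert _ _)

theorem fullTwist_mem_twistFlipSubgroup (n : ℕ) : fullTwist n ∈ twistFlipSubgroup n :=
  Subgroup.subset_closure (Set.mem_insert _ _)

theorem mem_or_mul_fullTwist_mem {n : ℕ} {g : BraidGroup n} (hg : g ∈ twistFlipSubgroup n) :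
    g ∈ flipSubgroup n ∨ g * fullTwist n ∈ flipSubgroup n := by
  have hd := Subgroup.mem_center_iff.1 (fullTwist_mem_center n)
  have hd2 := fullTwist_sq_mem n
  rw [pow_two] at hd2
  induction hg using Subgroup.closure_induction with
  | mem x hx =>
    obtain rfl | ⟨i, rfl⟩ := hx
    · exact Or.inr hd2
    · exact Or.inl (strandFlip_mem i)
  | one => exact Or.inl (one_mem _)
  | mul x y _ _ hx hy =>
    rcases hx with hx | hx <;> rcases hy with hy | hy
    · exact Or.inl (mul_mem hx hy)
    · exact Or.inr (by rw [mul_assoc]; exact mul_mem hx hy)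
    · exact Or.inr (by rw [mul_assoc, hd y, ← mul_assoc]; exact mul_mem hx hy)
    · left
      have h := mul_mem (mul_mem hx hy) (inv_mem hd2)
      have e : x * fullTwist n * (y * fullTwist n) = x * y * (fullTwist n * fullTwist n) := by
        rw [mul_assoc, ← mul_assoc _ y, ← hd y]; simp only [mul_assoc]
      rwa [e, mul_inv_cancel_right] at h
  | inv x _ hx =>
    rcases hx with hx | hx
    · exact Or.inl (inv_mem hx)
    · right
      have h := mul_mem (inv_mem hx) hd2
      rwa [hd x, mul_inv_rev, mul_assoc, inv_mul_cancel_left] at h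

theorem index_flipSubgroup_subgroupOf {n : ℕ} (hn : 3 ≤ n) :
    ((flipSubgroup n).subgroupOf (twistFlipSubgroup n)).index = 2 := by
  rw [Subgroup.index_eq_two_iff]
  refine ⟨⟨_, fullTwist_mem_twistFlipSubgroup n⟩, fun g => ?_⟩
  simp only [Subgroup.mem_subgroupOf, Subgroup.coe_mul]
  rcases mem_or_mul_fullTwist_mem g.2 with h | h
  · exact Or.inr ⟨h, fun h' => fullTwist_notMem_flipSubgroup hn ((mul_mem_cancel_left h).1 h')⟩
  · exact Or.inl ⟨h, fun h' => fullTwist_notMem_flipSubgroup hn ((mul_mem_cancel_left h').1 h)⟩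

end BraidGroup

theorem mainTheorem5 (n : ℕ) (hn : 3 ≤ n) :
    BraidGroup.flipSubgroup n ≤ BraidGroup.twistFlipSubgroup n ∧
    BraidGroup.twistFlipSubgroup n ≤ BraidGroup.pureSubgroup n ∧
    ∃ _ : ((BraidGroup.flipSubgroup n).subgroupOf (BraidGroup.twistFlipSubgroup n)).Normal,
      Nonempty ((BraidGroup.twistFlipSubgroup n ⧸
          (BraidGroup.flipSubgroup n).subgroupOf (BraidGroup.twistFlipSubgroup n)) ≃*
        Multiplicative (ZMod 2)) ∧
      (Nonempty ((BraidGroup.twistFlipSubgroup n ⧸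
          (BraidGroup.flipSubgroup n).subgroupOf (BraidGroup.twistFlipSubgroup n)) ≃*
        Multiplicative (ZMod 2)) ↔
        BraidGroup.fullTwist n ^ 2 ∈ BraidGroup.flipSubgroup n ∧
        BraidGroup.fullTwist n ∉ BraidGroup.flipSubgroup n) := by
  have hindex := BraidGroup.index_flipSubgroup_subgroupOf hn
  have hnormal := Subgroup.normal_of_index_eq_two hindex
  have hiso : Nonempty ((BraidGroup.twistFlipSubgroup n ⧸
      (BraidGroup.flipSubgroup n).subgroupOf (BraidGroup.twistFlipSubgroup n)) ≃*
        Multiplicative (ZMod 2)) :=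
    ⟨mulEquivOfPrimeCardEq (p := 2) hindex (by simp)⟩
  exact ⟨BraidGroup.flipSubgroup_le_twistFlipSubgroup n,
    BraidGroup.twistFlipSubgroup_le_pureSubgroup n, hnormal, hiso,
    fun _ => ⟨BraidGroup.fullTwist_sq_mem n, BraidGroup.fullTwist_notMem_flipSubgroup hn⟩,
    fun _ => hiso⟩
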